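/- Let $\{D_i\}_{i\ge 1}$ be a (strictly) stationary sequence of positive random variables and let $\{\vec V_i\}_{i\ge 1}$ be a (strictly) stationary sequence of square-integrable $\mathbb{R}^6$-valued random vectors, defined on the same probability space. Suppose that, for a constant $\lambda>0$ and a constant vector $\vec{\bar V}\in\mathbb{R}^6$, $$\frac{D_1+\cdots+D_i}{i}\to\frac1\lambda\quad\text{and}\quad \frac{\vec V_1+\cdots+\vec V_i}{i}\to\vec{\bar V}\qquad\text{in probability as } i\to\infty .$$ Let $N(t)=\max\{m\ge 0: \sum_{i=1}^m D_i\le t\}$ for $t\ge 0$, and let $\vec C_n(t)=\frac1n\sum_{i=1}^{N(nt)}\vec V_i$ for $n \ge 1$. Then, almost surely, the maximum defining $N(t)$ exists for all $t\ge0$, and for every $T>0$ the paths of all $\vec C_n$ on $[0,T]$ are almost surely càdlàg and $$\vec C_n\Rightarrow \big(t\mapsto\lambda\vec{\bar V}\,t\big)\qquad\text{as } n\to\infty,$$ where $\Rightarrow$ is weak convergence of laws on the space $D^6[0,T]$ of càdlàg functions $[0,T]\to\mathbb{R}^6$ with the Skorokhod $J_1$ topology. -/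

import Mathlib

open MeasureTheory ProbabilityTheory Filter Topology
open scoped ENNReal

noncomputable section

/-- A function on `[0, T]` is càdlàg: right-continuous with left limits at every point.
At `0` the left-limit condition, and at `T` the right-continuity condition, is vacuous, since
`[0, T]` is regarded as a space of its own. -/
def IsCadlag {T : ℝ} {E : Type*} [TopologicalSpace E] (x : Set.Icc (0 : ℝ) T → E) : Prop :=
  ∀ t, ContinuousWithinAt x (Set.Ici t) t ∧ ∃ l, Tendsto x (𝓝[<] t) (𝓝 l)

/-- The Skorokhod space `D([0, T], E)` of càdlàg functions `[0, T] → E`. -/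
structure CadlagPath (T : ℝ) (E : Type*) [TopologicalSpace E] where
  /-- the underlying function -/
  toFun : Set.Icc (0 : ℝ) T → E
  /-- it is right-continuous with left limits -/
  isCadlag : IsCadlag toFun

namespace CadlagPath

/-- A continuous function is a càdlàg path. -/
def ofContinuous {T : ℝ} {E : Type*} [TopologicalSpace E] (x : Set.Icc (0 : ℝ) T → E)
    (hx : Continuous x) : CadlagPath T E where
  toFun := x
  isCadlag t := ⟨hx.continuousWithinAt, x t, (hx.tendsto t).mono_left nhdsWithin_le_nhds⟩

open Classical in
/-- The càdlàg path given by `x` if `x` is càdlàg, and the zero path otherwise. It is used for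
random functions that are càdlàg almost surely. -/
def ofFun {T : ℝ} {E : Type*} [TopologicalSpace E] [Zero E] (x : Set.Icc (0 : ℝ) T → E) :
    CadlagPath T E :=
  if hx : IsCadlag x then ⟨x, hx⟩ else ofContinuous (fun _ => 0) continuous_const

/-- The cost of matching the path `x` with the path `y` by the time change `φ`, an increasing
bijection of `[0, T]` onto itself: the maximum of `sup_t |φ t - t|` and
`sup_t d(x t, y (φ t))`. -/
def matchCost {T : ℝ} {E : Type*} [PseudoEMetricSpace E] (x y : CadlagPath T E)
    (φ : Set.Icc (0 : ℝ) T ≃o Set.Icc (0 : ℝ) T) : ℝ≥0∞ :=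
  max (⨆ t, edist (φ t) t) (⨆ t, edist (x.toFun t) (y.toFun (φ t)))

theorem matchCost_symm {T : ℝ} {E : Type*} [PseudoEMetricSpace E] (x y : CadlagPath T E)
    (φ : Set.Icc (0 : ℝ) T ≃o Set.Icc (0 : ℝ) T) :
    matchCost y x φ.symm = matchCost x y φ := by
  unfold matchCost
  congr 1
  · rw [← φ.toEquiv.iSup_comp]
    simp [edist_comm]
  · rw [← φ.toEquiv.iSup_comp]
    simp [edist_comm]

theorem matchCost_trans {T : ℝ} {E : Type*} [PseudoEMetricSpace E] (x y z : CadlagPath T E)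
    (φ ψ : Set.Icc (0 : ℝ) T ≃o Set.Icc (0 : ℝ) T) :
    matchCost x z (φ.trans ψ) ≤ matchCost x y φ + matchCost y z ψ := by
  have h1 : ∀ t, edist (φ t) t ≤ matchCost x y φ := fun t =>
    (le_iSup (fun t => edist (φ t) t) t).trans (le_max_left _ _)
  have h2 : ∀ t, edist (x.toFun t) (y.toFun (φ t)) ≤ matchCost x y φ := fun t =>
    (le_iSup (fun t => edist (x.toFun t) (y.toFun (φ t))) t).trans (le_max_right _ _)
  have h3 : ∀ t, edist (ψ t) t ≤ matchCost y z ψ := fun t =>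
    (le_iSup (fun t => edist (ψ t) t) t).trans (le_max_left _ _)
  have h4 : ∀ t, edist (y.toFun t) (z.toFun (ψ t)) ≤ matchCost y z ψ := fun t =>
    (le_iSup (fun t => edist (y.toFun t) (z.toFun (ψ t))) t).trans (le_max_right _ _)
  refine max_le (iSup_le fun t => ?_) (iSup_le fun t => ?_)
  · calc edist (ψ (φ t)) t ≤ edist (ψ (φ t)) (φ t) + edist (φ t) t := edist_triangle _ _ _
      _ ≤ matchCost y z ψ + matchCost x y φ := add_le_add (h3 _) (h1 _)
      _ = _ := add_comm _ _
  · exact (edist_triangle _ (y.toFun (φ t)) _).trans (add_le_add (h2 _) (h4 _))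

/-- Skorokhod's metric `inf_φ max (sup_t |φ t - t|) (sup_t d(x t, y (φ t)))` on `D([0, T], E)`,
the infimum being over all increasing bijections `φ` of `[0, T]`. Its topology is the (strong)
`J₁` topology. -/
instance {T : ℝ} {E : Type*} [PseudoEMetricSpace E] : PseudoEMetricSpace (CadlagPath T E) where
  edist x y := ⨅ φ : Set.Icc (0 : ℝ) T ≃o Set.Icc (0 : ℝ) T, matchCost x y φ
  edist_self x := by
    refine le_antisymm (iInf_le_of_le (OrderIso.refl _) ?_) zero_le
    simp [matchCost]
  edist_comm x y := by
    refine le_antisymm (le_iInf fun φ => ?_) (le_iInf fun φ => ?_)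
    · exact iInf_le_of_le φ.symm (matchCost_symm y x φ).le
    · exact iInf_le_of_le φ.symm (matchCost_symm x y φ).le
  edist_triangle x y z := by
    rw [ENNReal.iInf_add]
    refine le_iInf fun φ => ?_
    rw [ENNReal.add_iInf]
    exact le_iInf fun ψ => iInf_le_of_le (φ.trans ψ) (matchCost_trans x y z φ ψ)

/-- The Borel σ-algebra of the `J₁` topology. -/
instance {T : ℝ} {E : Type*} [PseudoEMetricSpace E] : MeasurableSpace (CadlagPath T E) :=
  borel _

instance {T : ℝ} {E : Type*} [PseudoEMetricSpace E] : BorelSpace (CadlagPath T E) := ⟨rfl⟩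

end CadlagPath

/-- The sequence `X 0, X 1, …` of random elements is (strictly) stationary: for every `k`, the
shifted sequence `X k, X (k + 1), …` has the same law as the sequence itself. -/
def IsStationarySeq {Ω E : Type*} [MeasurableSpace Ω] [MeasurableSpace E] (X : ℕ → Ω → E)
    (P : Measure Ω) : Prop :=
  ∀ k : ℕ, IdentDistrib (fun ω i => X (i + k) ω) (fun ω i => X i ω) P P

/-- The weak law of large numbers with limit `m`: the averages of the first `n` terms converge
to the constant `m` in probability. -/
def WeakLLN {Ω E : Type*} [MeasurableSpace Ω] [NormedAddCommGroup E] [NormedSpace ℝ E]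
    (X : ℕ → Ω → E) (P : Measure Ω) (m : E) : Prop :=
  TendstoInMeasure P (fun (n : ℕ) ω => (n : ℝ)⁻¹ • ∑ i ∈ Finset.range n, X i ω) atTop
    (fun _ => m)

/-- The arrival counting function `N(t) = max {m : d₁ + ⋯ + d_m ≤ t}` of a sequence of
inter-arrival times; the sequence is indexed from `0`, so `d i` is the `(i+1)`-st time. -/
def arrivalCount (d : ℕ → ℝ) (t : ℝ) : ℕ :=
  sSup {m : ℕ | ∑ i ∈ Finset.range m, d i ≤ t}

/-- The scaled net order flow `C_n(t) = (1/n) ∑_{i ≤ N(nt)} v_i`. -/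
def netOrderFlow {E : Type*} [NormedAddCommGroup E] [NormedSpace ℝ E] (d : ℕ → ℝ) (v : ℕ → E)
    (n : ℕ) (t : ℝ) : E :=
  (n : ℝ)⁻¹ • ∑ i ∈ Finset.range (arrivalCount d (n * t)), v i

/-- The linear path `t ↦ (lam * t) • v` on `[0, T]`. -/
def linearPath {E : Type*} [NormedAddCommGroup E] [NormedSpace ℝ E] (T lam : ℝ) (v : E) :
    CadlagPath T E :=
  CadlagPath.ofContinuous (fun t => (lam * (t : ℝ)) • v) (by fun_prop)

end

noncomputable section

/-! ### Càdlàg functions -/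

/-! The convergence holds in probability in the uniform metric, which dominates Skorokhod's; since
the limit is deterministic, weak convergence follows once the paths are known to be random elements
of the Skorokhod space.

Both weak laws are first made uniform over `m ≤ M n`. For the positive `D i` this is Pólya's
argument: monotone partial sums that are close to a line on a finite grid are close to it in between
(`abs_sub_le_of_grid`). The `V i` have no sign, so stationarity replaces monotonicity: by uniform
integrability the weak law holds in `L¹`, hence a block of fixed large length `L` has centred sum of
mean norm at most `ε L`. Adding the norms of all blocks controls every partial sum up to an
incomplete block, which second moments make negligible; Markov's inequality concludes
(`norm_sum_range_le_block`). Inverting the first estimate gives `N(nt) ≈ λ n t`, and inserting this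
in the second gives the limit (`norm_netOrderFlow_sub_le`).

Measurability for the `J₁` Borel σ-algebra comes from splitting the probability space into countably
many events, by the number of jumps and by which of them occur at `T`. On each event the path is a
continuous function of finitely many jump times and jumps (`continuousOn_jumpPath`), because a small
piecewise linear time change carries jump times to nearby ones (`exists_timeChange`). -/

theorem IsCadlag.const {T : ℝ} {E : Type*} [TopologicalSpace E] (c : E) :
    IsCadlag (fun _ : Set.Icc (0 : ℝ) T => c) :=
  fun _ => ⟨continuousWithinAt_const, c, tendsto_const_nhds⟩

theorem IsCadlag.finset_sum {T : ℝ} {E : Type*} [TopologicalSpace E] [AddCommMonoid E]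
    [ContinuousAdd E] {ι : Type*} (s : Finset ι) {x : ι → Set.Icc (0 : ℝ) T → E}
    (hx : ∀ i ∈ s, IsCadlag (x i)) : IsCadlag (fun t => ∑ i ∈ s, x i t) := by
  intro t
  refine ⟨tendsto_finsetSum _ fun i hi => (hx i hi t).1, ?_⟩
  choose! l hl using fun i hi => (hx i hi t).2
  exact ⟨∑ i ∈ s, l i, tendsto_finsetSum _ hl⟩

theorem isCadlag_jump {T : ℝ} {E : Type*} [TopologicalSpace E] [Zero E] (s : ℝ) (v : E) :
    IsCadlag (fun t : Set.Icc (0 : ℝ) T => if s ≤ t then v else 0) := by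
  intro t
  constructor
  · rcases le_or_gt s t with h | h
    · refine ContinuousWithinAt.congr (f := fun _ => v) continuousWithinAt_const ?_ ?_
      · intro u hu
        exact if_pos (h.trans hu)
      · exact if_pos h
    · have : ∀ᶠ u : Set.Icc (0 : ℝ) T in 𝓝 t, (u : ℝ) < s :=
        continuous_subtype_val.continuousAt.eventually_lt continuousAt_const h
      refine ContinuousAt.continuousWithinAt ?_
      refine (continuousAt_const (y := (0 : E))).congr ?_
      filter_upwards [this] with u hu
      exact (if_neg (not_le.2 hu)).symm
  · rcases lt_or_ge s t with h | h
    · refine ⟨v, ?_⟩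
      have : ∀ᶠ u : Set.Icc (0 : ℝ) T in 𝓝 t, s < (u : ℝ) :=
        continuousAt_const.eventually_lt continuous_subtype_val.continuousAt h
      refine tendsto_const_nhds.congr' ?_
      filter_upwards [nhdsWithin_le_nhds this] with u hu
      exact (if_pos hu.le).symm
    · refine ⟨0, ?_⟩
      refine tendsto_const_nhds.congr' ?_
      filter_upwards [self_mem_nhdsWithin] with u hu
      have hu' : (u : ℝ) < t := hu
      exact (if_neg (not_le.2 (hu'.trans_le h))).symm

/-! ### Pure jump paths -/

/-- The path with the jump `v i` at the time `s i` for every `i`. -/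
def jumpPath (T : ℝ) {E ι : Type*} [Fintype ι] [NormedAddCommGroup E] (s : ι → ℝ) (v : ι → E) :
    CadlagPath T E where
  toFun t := ∑ i, if s i ≤ t then v i else 0
  isCadlag := IsCadlag.finset_sum _ fun i _ => isCadlag_jump (s i) (v i)

/-- The identity is an admissible time change. -/
theorem CadlagPath.edist_le_iSup {T : ℝ} {E : Type*} [PseudoEMetricSpace E]
    (x y : CadlagPath T E) : edist x y ≤ ⨆ t, edist (x.toFun t) (y.toFun t) := by
  refine iInf_le_of_le (OrderIso.refl _) ?_
  simp [CadlagPath.matchCost]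

/-- The tent function with peak `1` at `a` and support of radius `δ`. -/
def tent (δ a t : ℝ) : ℝ := max 0 (1 - |t - a| / δ)

theorem tent_self {δ : ℝ} (a : ℝ) : tent δ a a = 1 := by simp [tent]

theorem tent_eq_zero {δ a t : ℝ} (hδ : 0 < δ) (h : δ ≤ |t - a|) : tent δ a t = 0 := by
  have : 1 ≤ |t - a| / δ := (one_le_div hδ).2 h
  simp [tent, this]

theorem abs_tent_le_one {δ a t : ℝ} (hδ : 0 < δ) : |tent δ a t| ≤ 1 := by
  have : 0 ≤ |t - a| / δ := by positivity
  rw [tent, abs_of_nonneg (le_max_left _ _)]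
  exact max_le zero_le_one (by linarith)

theorem abs_tent_sub_le {δ : ℝ} (hδ : 0 < δ) (a t u : ℝ) :
    |tent δ a t - tent δ a u| ≤ |t - u| / δ := by
  refine (abs_max_sub_max_le_max _ _ _ _).trans ?_
  rw [sub_self, abs_zero]
  refine max_le (by positivity) ?_
  rw [show 1 - |t - a| / δ - (1 - |u - a| / δ) = (|u - a| - |t - a|) / δ by ring, abs_div,
    abs_of_pos hδ]
  refine div_le_div_of_nonneg_right ?_ hδ.le
  refine (abs_abs_sub_abs_le (u - a) (t - a)).trans ?_
  rw [show u - a - (t - a) = -(t - u) by ring, abs_neg]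

theorem continuous_tent (δ a : ℝ) : Continuous (tent δ a) := by
  unfold tent; fun_prop

/-- A strictly monotone continuous map of `ℝ` fixing `0` and `T` restricts to an order automorphism
of `[0, T]`. -/
theorem exists_orderIso_Icc {T : ℝ} (hT : 0 ≤ T) {g : ℝ → ℝ} (hg : StrictMono g)
    (hc : Continuous g) (h0 : g 0 = 0) (hgT : g T = T) :
    ∃ φ : Set.Icc (0 : ℝ) T ≃o Set.Icc (0 : ℝ) T, ∀ t, (φ t : ℝ) = g t := by
  have hmaps : ∀ t : Set.Icc (0 : ℝ) T, g t ∈ Set.Icc (0 : ℝ) T := fun t =>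
    ⟨h0.symm.le.trans (hg.monotone t.2.1), (hg.monotone t.2.2).trans_eq hgT⟩
  let f : Set.Icc (0 : ℝ) T → Set.Icc (0 : ℝ) T := fun t => ⟨g t, hmaps t⟩
  have hf : StrictMono f := fun a b hab => hg hab
  have hsurj : Function.Surjective f := by
    intro y
    have hy : (y : ℝ) ∈ Set.Icc (g 0) (g T) := by rw [h0, hgT]; exact y.2
    obtain ⟨x, hx, hxy⟩ := intermediate_value_Icc hT hc.continuousOn hy
    exact ⟨⟨x, hx⟩, Subtype.ext hxy⟩
  exact ⟨hf.orderIsoOfSurjective f hsurj, fun t => rfl⟩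

/-- Times `s i` in `(0, T]` can be moved to any sufficiently close times by a time change of
`[0, T]` that is close to the identity, as long as the times equal to `T` do not move. -/
theorem exists_timeChange {T : ℝ} {ι : Type*} [Fintype ι] {s : ι → ℝ}
    (hs : Function.Injective s) (hpos : ∀ i, 0 < s i) (hT : 0 ≤ T) :
    ∃ η > 0, ∀ s' : ι → ℝ, ∑ i, |s' i - s i| < η → (∀ i, s i = T → s' i = T) →
      ∃ φ : Set.Icc (0 : ℝ) T ≃o Set.Icc (0 : ℝ) T,
        (∀ i, ∀ t, s' i ≤ φ t ↔ s i ≤ t) ∧ ∀ t, |(φ t : ℝ) - t| ≤ ∑ i, |s' i - s i| := by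
  -- A tent of radius `δ` at `s i` then vanishes at `0`, at the other jump times, and at `T` unless
  -- `s i = T`.
  obtain ⟨δ, ⟨h1, h2, h3⟩, hδ⟩ : ∃ δ : ℝ, ((∀ i, δ ≤ s i) ∧ (∀ i j, i ≠ j → δ ≤ |s i - s j|) ∧
      ∀ i, s i ≠ T → δ ≤ |T - s i|) ∧ 0 < δ := by
    have hev : ∀ c : ℝ, 0 < c → ∀ᶠ δ in 𝓝[>] (0 : ℝ), δ ≤ c := fun c hc =>
      (eventually_le_nhds hc).filter_mono nhdsWithin_le_nhds
    refine Eventually.exists (f := 𝓝[>] (0 : ℝ)) (((eventually_all.2 fun i => hev _ (hpos i)).and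
      ((eventually_all.2 fun i => eventually_all.2 fun j => ?_).and
        (eventually_all.2 fun i => ?_))).and self_mem_nhdsWithin)
    · by_cases hij : i = j
      · simp [hij]
      · filter_upwards [hev _ (abs_pos.2 (sub_ne_zero.2 (hs.ne hij)))] with δ hδ _ using hδ
    · by_cases hi : s i = T
      · simp [hi]
      · filter_upwards [hev _ (abs_pos.2 (sub_ne_zero.2 (Ne.symm hi)))] with δ hδ _ using hδ
  refine ⟨δ, hδ, fun s' hsum hsT => ?_⟩
  set c : ι → ℝ := fun i => s' i - s i with hc
  -- The perturbation of the identity has Lipschitz constant at most `(∑ |c i|) / δ`, which is below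
  -- `1`; this is why `η = δ` works.
  let g : ℝ → ℝ := fun t => t + ∑ i, c i * tent δ (s i) t
  have hgs : ∀ i, g (s i) = s' i := by
    intro i
    have : ∑ j, c j * tent δ (s j) (s i) = c i := by
      rw [Finset.sum_eq_single i]
      · rw [tent_self, mul_one]
      · intro j _ hji
        rw [tent_eq_zero hδ (h2 i j hji.symm), mul_zero]
      · simp
    simp only [g]
    rw [this, hc]
    ring
  have hg0 : g 0 = 0 := by
    have : ∀ j, tent δ (s j) 0 = 0 := fun j => by
      refine tent_eq_zero hδ ?_
      rw [zero_sub, abs_neg, abs_of_pos (hpos j)]; exact h1 j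
    simp [g, this]
  have hgT : g T = T := by
    have : ∀ j, c j * tent δ (s j) T = 0 := fun j => by
      by_cases hj : s j = T
      · simp [hc, hj, hsT j hj]
      · rw [tent_eq_zero hδ (h3 j hj), mul_zero]
    simp [g, this]
  have hmono : StrictMono g := by
    intro u t hut
    have hb : |∑ i, c i * tent δ (s i) t - ∑ i, c i * tent δ (s i) u|
        ≤ (∑ i, |c i|) * ((t - u) / δ) := by
      rw [← Finset.sum_sub_distrib, Finset.sum_mul]
      refine (Finset.abs_sum_le_sum_abs _ _).trans (Finset.sum_le_sum fun i _ => ?_)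
      rw [← mul_sub, abs_mul]
      refine mul_le_mul_of_nonneg_left ?_ (abs_nonneg _)
      exact (abs_tent_sub_le hδ _ _ _).trans_eq (by rw [abs_of_pos (sub_pos.2 hut)])
    have hlt : (∑ i, |c i|) * ((t - u) / δ) < t - u := by
      calc _ < δ * ((t - u) / δ) :=
            mul_lt_mul_of_pos_right hsum (div_pos (sub_pos.2 hut) hδ)
        _ = t - u := by field_simp
    have := (abs_le.1 hb).1
    simp only [g]; linarith
  have hcont : Continuous g := by
    refine continuous_id.add (continuous_finsetSum _ fun i _ => ?_)
    exact continuous_const.mul (continuous_tent _ _)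
  obtain ⟨φ, hφ⟩ := exists_orderIso_Icc hT hmono hcont hg0 hgT
  refine ⟨φ, fun i t => ?_, fun t => ?_⟩
  · rw [hφ, ← hgs i, hmono.le_iff_le]
  · rw [hφ]
    simp only [g, add_sub_cancel_left]
    refine (Finset.abs_sum_le_sum_abs _ _).trans (Finset.sum_le_sum fun i _ => ?_)
    rw [abs_mul]
    exact mul_le_of_le_one_right (abs_nonneg _) (abs_tent_le_one hδ)

/-- The jump times `s` are strictly increasing in `(0, T]`, and `J` is the set of indices of the
jump times equal to `T`. -/
def jumpTimes (T : ℝ) {k : ℕ} (J : Set (Fin k)) : Set (Fin k → ℝ) :=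
  {s | (∀ i j, i < j → s i < s j) ∧ (∀ i, 0 < s i) ∧ (∀ i, s i ≤ T) ∧ ∀ i, s i = T ↔ i ∈ J}

theorem measurableSet_jumpTimes (T : ℝ) {k : ℕ} (J : Set (Fin k)) :
    MeasurableSet (jumpTimes T J) := by
  have hm : ∀ i, Measurable fun s : Fin k → ℝ => s i := fun i => measurable_pi_apply i
  have h : ∀ i, MeasurableSet {s : Fin k → ℝ | s i = T ↔ i ∈ J} := fun i => by
    by_cases hi : i ∈ J
    · simpa [hi] using measurableSet_eq_fun (hm i) measurable_const
    · simp only [hi, iff_false]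
      exact (measurableSet_eq_fun (hm i) measurable_const).compl
  refine MeasurableSet.inter (s₁ := {s : Fin k → ℝ | ∀ i j, i < j → s i < s j}) ?_
    (MeasurableSet.inter (s₁ := {s : Fin k → ℝ | ∀ i, 0 < s i}) ?_
    (MeasurableSet.inter (s₁ := {s : Fin k → ℝ | ∀ i, s i ≤ T})
      (s₂ := {s : Fin k → ℝ | ∀ i, s i = T ↔ i ∈ J}) ?_ ?_))
  · simp only [Set.ofPred_forall]
    exact MeasurableSet.iInter fun i => MeasurableSet.iInter fun j => MeasurableSet.iInter fun _ =>
      measurableSet_lt (hm i) (hm j)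
  · simp only [Set.ofPred_forall]
    exact MeasurableSet.iInter fun i => measurableSet_lt measurable_const (hm i)
  · simp only [Set.ofPred_forall]
    exact MeasurableSet.iInter fun i => measurableSet_le (hm i) measurable_const
  · simp only [Set.ofPred_forall]
    exact MeasurableSet.iInter h

/-- A pure jump path depends continuously on its jump times and jumps. -/
theorem continuousOn_jumpPath {T : ℝ} (hT : 0 ≤ T) {E : Type*} [NormedAddCommGroup E] {k : ℕ}
    (J : Set (Fin k)) :
    ContinuousOn (fun p : (Fin k → ℝ) × (Fin k → E) => jumpPath T p.1 p.2)
      {p | p.1 ∈ jumpTimes T J} := by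
  rintro ⟨s, v⟩ ⟨hlt, hpos, hle, hJ⟩
  have hinj : Function.Injective s := (show StrictMono s from fun i j => hlt i j).injective
  obtain ⟨η, hη, H⟩ := exists_timeChange hinj hpos hT
  rw [ContinuousWithinAt, tendsto_iff_edist_tendsto_0]
  let A : (Fin k → ℝ) × (Fin k → E) → ℝ := fun p => ∑ i, |p.1 i - s i|
  let B : (Fin k → ℝ) × (Fin k → E) → ℝ := fun p => ∑ i, ‖p.2 i - v i‖
  have hA : Continuous A := by fun_prop
  have hB : Continuous B := by fun_prop
  have hA0 : A (s, v) = 0 := by simp [A]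
  have hB0 : B (s, v) = 0 := by simp [B]
  have hlim : Tendsto (fun p => ENNReal.ofReal (max (A p) (B p)))
      (𝓝[{p | p.1 ∈ jumpTimes T J}] (s, v)) (𝓝 0) := by
    have h := (ENNReal.continuous_ofReal.comp (hA.max hB)).tendsto (s, v)
    simp only [Function.comp_def, hA0, hB0, max_self, ENNReal.ofReal_zero] at h
    exact h.mono_left nhdsWithin_le_nhds
  refine tendsto_of_tendsto_of_tendsto_of_le_of_le' tendsto_const_nhds hlim
    (Eventually.of_forall fun _ => zero_le) ?_
  have hev : ∀ᶠ p in 𝓝[{p | p.1 ∈ jumpTimes T J}] (s, v), A p < η :=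
    nhdsWithin_le_nhds (hA.continuousAt.eventually_lt continuousAt_const (by rwa [hA0]))
  filter_upwards [hev, self_mem_nhdsWithin] with p hp hpJ
  -- Time changes fix `T`, so a jump at `T` cannot be matched with one before `T`. Fixing `J`
  -- excludes this.
  obtain ⟨φ, hφ, hφ'⟩ := H p.1 hp fun i hi => (hpJ.2.2.2 i).2 ((hJ i).1 hi)
  rw [edist_comm]
  refine iInf_le_of_le φ (max_le (iSup_le fun t => ?_) (iSup_le fun t => ?_))
  · rw [Subtype.edist_eq, edist_dist, Real.dist_eq]
    exact ENNReal.ofReal_le_ofReal ((hφ' t).trans (le_max_left _ _))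
  · rw [edist_dist]
    refine ENNReal.ofReal_le_ofReal (le_trans ?_ (le_max_right _ _))
    simp only [jumpPath, hφ]
    refine (dist_sum_sum_le _ _ _).trans (Finset.sum_le_sum fun i _ => ?_)
    split_ifs
    · rw [dist_comm, dist_eq_norm]
    · simp

/-- A random pure jump path with measurable jump times and jumps is measurable where the jump times
are strictly increasing. -/
theorem aemeasurable_restrict_jumpPath {Ω : Type*} [MeasurableSpace Ω] (P : Measure Ω) {T : ℝ}
    (hT : 0 ≤ T) {E : Type*} [NormedAddCommGroup E] [MeasurableSpace E] [BorelSpace E]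
    [SecondCountableTopology E] {k : ℕ} (J : Set (Fin k)) {s : Ω → Fin k → ℝ} {v : Ω → Fin k → E}
    (hs : Measurable s) (hv : Measurable v) :
    AEMeasurable (fun ω => jumpPath T (s ω) (v ω)) (P.restrict (s ⁻¹' jumpTimes T J)) := by
  refine aemeasurable_restrict_of_measurable_subtype (hs (measurableSet_jumpTimes T J)) ?_
  have hc := continuousOn_iff_continuous_domRestrict.1 (continuousOn_jumpPath (E := E) hT J)
  refine hc.measurable.comp (f := fun x : s ⁻¹' jumpTimes T J => (⟨(s x, v x), x.2⟩ :
    {p : (Fin k → ℝ) × (Fin k → E) | p.1 ∈ jumpTimes T J})) ?_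
  exact Measurable.subtype_mk
    ((hs.comp measurable_subtype_coe).prodMk (hv.comp measurable_subtype_coe))

/-! ### The arrival counting function -/

theorem isGreatest_arrivalCount {d : ℕ → ℝ}
    (hS : Tendsto (fun m => ∑ i ∈ Finset.range m, d i) atTop atTop) {t : ℝ} (ht : 0 ≤ t) :
    IsGreatest {m : ℕ | ∑ i ∈ Finset.range m, d i ≤ t} (arrivalCount d t) := by
  have hne : {m : ℕ | ∑ i ∈ Finset.range m, d i ≤ t}.Nonempty := ⟨0, by simpa using ht⟩
  have hbdd : BddAbove {m : ℕ | ∑ i ∈ Finset.range m, d i ≤ t} := by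
    obtain ⟨N, hN⟩ := eventually_atTop.1 (hS.eventually_gt_atTop t)
    refine ⟨N, fun m hm => ?_⟩
    by_contra h
    exact absurd hm (not_le.2 (hN m (not_le.1 h).le))
  exact ⟨Nat.sSup_mem hne hbdd, fun m hm => le_csSup hbdd hm⟩

theorem monotone_sum_range {d : ℕ → ℝ} (hd : ∀ i, 0 ≤ d i) :
    Monotone fun m => ∑ i ∈ Finset.range m, d i :=
  monotone_nat_of_le_succ fun m => by
    rw [Finset.sum_range_succ]; exact le_add_of_nonneg_right (hd m)

/-- Monotone partial sums make the set of admissible `m` an initial segment. This inversion turns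
statements about `N` into statements about partial sums. -/
theorem le_arrivalCount_iff {d : ℕ → ℝ} (hd : ∀ i, 0 ≤ d i)
    (hS : Tendsto (fun m => ∑ i ∈ Finset.range m, d i) atTop atTop) {t : ℝ} (ht : 0 ≤ t) {m : ℕ} :
    m ≤ arrivalCount d t ↔ ∑ i ∈ Finset.range m, d i ≤ t :=
  ⟨fun h => (monotone_sum_range hd h).trans (isGreatest_arrivalCount hS ht).1,
    fun h => (isGreatest_arrivalCount hS ht).2 h⟩

/-! ### The net order flow -/

/-- On `[0, T]` the net order flow is a pure jump path with `N(nT)` jumps. -/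
theorem netOrderFlow_eq_sum {E : Type*} [NormedAddCommGroup E] [NormedSpace ℝ E] {d : ℕ → ℝ}
    (hd : ∀ i, 0 ≤ d i) (hS : Tendsto (fun m => ∑ i ∈ Finset.range m, d i) atTop atTop)
    (v : ℕ → E) {n : ℕ} (hn : 0 < n) {T t : ℝ} (ht : 0 ≤ t) (htT : t ≤ T) {k : ℕ}
    (hk : arrivalCount d (n * T) = k) :
    netOrderFlow d v n t = ∑ i : Fin k,
      if (∑ j ∈ Finset.range (i + 1), d j) / n ≤ t then (n : ℝ)⁻¹ • v i else 0 := by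
  have hn' : (0 : ℝ) < n := by exact_mod_cast hn
  rw [Fin.sum_univ_eq_sum_range (fun i =>
    if (∑ j ∈ Finset.range (i + 1), d j) / n ≤ t then (n : ℝ)⁻¹ • v i else 0) k,
    ← Finset.sum_filter, netOrderFlow, Finset.smul_sum]
  congr 1
  ext i
  rw [Finset.mem_range, Finset.mem_filter, Finset.mem_range, div_le_iff₀ hn', mul_comm t,
    ← Nat.succ_le_iff, ← Nat.succ_le_iff, le_arrivalCount_iff hd hS (by positivity), ← hk,
    le_arrivalCount_iff hd hS (mul_nonneg hn'.le (ht.trans htT))]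
  refine ⟨fun h => ⟨h.trans ?_, h⟩, fun h => h.2⟩
  gcongr

theorem isCadlag_netOrderFlow {E : Type*} [NormedAddCommGroup E] [NormedSpace ℝ E] {d : ℕ → ℝ}
    (hd : ∀ i, 0 ≤ d i) (hS : Tendsto (fun m => ∑ i ∈ Finset.range m, d i) atTop atTop)
    (v : ℕ → E) (n : ℕ) (T : ℝ) :
    IsCadlag (fun t : Set.Icc (0 : ℝ) T => netOrderFlow d v n t) := by
  rcases Nat.eq_zero_or_pos n with rfl | hn
  · simpa [netOrderFlow] using IsCadlag.const (T := T) (0 : E)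
  · have := (jumpPath T (fun i : Fin (arrivalCount d (n * T)) =>
      (∑ j ∈ Finset.range (i + 1), d j) / n) fun i => (n : ℝ)⁻¹ • v i).isCadlag
    convert! this using 1
    ext1 t
    exact netOrderFlow_eq_sum hd hS v hn t.2.1 t.2.2 rfl

theorem CadlagPath.ofFun_eq {T : ℝ} {E : Type*} [TopologicalSpace E] [Zero E]
    {x : Set.Icc (0 : ℝ) T → E} (hx : IsCadlag x) : CadlagPath.ofFun x = ⟨x, hx⟩ :=
  dif_pos hx

theorem ofFun_netOrderFlow_eq_jumpPath {E : Type*} [NormedAddCommGroup E] [NormedSpace ℝ E]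
    {d : ℕ → ℝ} (hd : ∀ i, 0 ≤ d i)
    (hS : Tendsto (fun m => ∑ i ∈ Finset.range m, d i) atTop atTop)
    (v : ℕ → E) {n : ℕ} (hn : 0 < n) {T : ℝ} {k : ℕ} (hk : arrivalCount d (n * T) = k) :
    CadlagPath.ofFun (fun t : Set.Icc (0 : ℝ) T => netOrderFlow d v n t) =
      jumpPath T (fun i : Fin k => (∑ j ∈ Finset.range (i + 1), d j) / n)
        fun i => (n : ℝ)⁻¹ • v i := by
  rw [CadlagPath.ofFun_eq (isCadlag_netOrderFlow hd hS v n T)]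
  simp only [jumpPath, CadlagPath.mk.injEq]
  ext1 t
  exact netOrderFlow_eq_sum hd hS v hn t.2.1 t.2.2 hk

/-- If the partial sums of the inter-arrival times and of the order sizes are uniformly close to
linear functions, so is the net order flow. -/
theorem norm_netOrderFlow_sub_le {E : Type*} [NormedAddCommGroup E] [NormedSpace ℝ E] {d : ℕ → ℝ}
    (hd : ∀ i, 0 ≤ d i) (hS : Tendsto (fun m => ∑ i ∈ Finset.range m, d i) atTop atTop)
    {v : ℕ → E} {n M : ℕ} (hn : 0 < n) {lam η T t : ℝ} (hlam : 0 < lam) {w : E}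
    (h1 : ∀ m ≤ M * n, |∑ i ∈ Finset.range m, d i - m / lam| ≤ η * n)
    (h2 : ∀ m ≤ M * n, ‖∑ i ∈ Finset.range m, v i - (m : ℝ) • w‖ ≤ η * n)
    (hM : T + η < M / lam) (ht : 0 ≤ t) (htT : t ≤ T) :
    ‖netOrderFlow d v n t - (lam * t) • w‖ ≤ η + (lam * η + 1 / n) * ‖w‖ := by
  have hn' : (0 : ℝ) < n := by exact_mod_cast hn
  have hnt : 0 ≤ (n : ℝ) * t := by positivity
  set k := arrivalCount d (n * t) with hk
  have hk1 : ∑ i ∈ Finset.range k, d i ≤ n * t := (le_arrivalCount_iff hd hS hnt).1 le_rfl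
  have hk2 : n * t < ∑ i ∈ Finset.range (k + 1), d i := by
    by_contra h
    have := (le_arrivalCount_iff hd hS hnt).2 (not_lt.1 h)
    omega
  -- Otherwise the sum of the first `M n` times would be at most `n T`, while `h1` and `hM` force it
  -- above. Strictness makes `h1` available at `k + 1` too.
  have hkM : k < M * n := by
    by_contra h
    have h3 := (monotone_sum_range hd (not_lt.1 h)).trans hk1
    have h4 := (abs_le.1 (h1 _ le_rfl)).1
    have h5 : (n : ℝ) * t ≤ n * T := by gcongr
    have h6 := mul_lt_mul_of_pos_right hM hn'
    push_cast at h4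
    have h7 : (M : ℝ) * n / lam = M / lam * n := by ring
    simp only at h3
    nlinarith
  have h3 := (abs_le.1 (h1 k hkM.le)).1
  have h4 := (abs_le.1 (h1 (k + 1) hkM)).2
  have h5 : |(k : ℝ) - lam * (n * t)| ≤ lam * (η * n) + 1 := by
    have e1 : lam * ((k : ℝ) / lam) = k := by field_simp
    have e2 : lam * (((k + 1 : ℕ) : ℝ) / lam) = k + 1 := by push_cast; field_simp
    have i1 : lam * (k / lam) ≤ lam * (n * t + η * n) := by gcongr; linarith
    have i2 : lam * (n * t) ≤ lam * (((k + 1 : ℕ) : ℝ) / lam + η * n) := by gcongr; linarith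
    rw [abs_le]; constructor <;> linarith
  have h6 : netOrderFlow d v n t - (lam * t) • w =
      (n : ℝ)⁻¹ • ((∑ i ∈ Finset.range k, v i - (k : ℝ) • w) +
        ((k : ℝ) - lam * (n * t)) • w) := by
    rw [netOrderFlow, ← hk, sub_smul, sub_add_sub_cancel, smul_sub, smul_smul]
    congr 2
    field_simp
  rw [h6, norm_smul, Real.norm_of_nonneg (by positivity), inv_mul_le_iff₀ hn']
  calc _ ≤ η * n + (lam * (η * n) + 1) * ‖w‖ := by
        refine (norm_add_le _ _).trans (add_le_add (h2 k hkM.le) ?_)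
        rw [norm_smul, Real.norm_eq_abs]
        gcongr
    _ = _ := by field_simp

/-! ### The arrival times -/

/-- Along a subsequence the averages converge almost surely to `c > 0`, so the sums diverge there;
monotonicity extends this to the whole sequence. -/
theorem ae_pos_and_tendsto_sum_atTop {Ω : Type*} [MeasurableSpace Ω] {P : Measure Ω}
    {D : ℕ → Ω → ℝ} (hpos : ∀ i, ∀ᵐ ω ∂P, 0 < D i ω) {c : ℝ} (hc : 0 < c) (h : WeakLLN D P c) :
    ∀ᵐ ω ∂P, (∀ i, 0 < D i ω) ∧
      Tendsto (fun m => ∑ i ∈ Finset.range m, D i ω) atTop atTop := by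
  obtain ⟨ns, hns, hlim⟩ := TendstoInMeasure.exists_seq_tendsto_ae h
  filter_upwards [ae_all_iff.2 hpos, hlim] with ω hω hl
  refine ⟨hω, tendsto_atTop_of_monotone_of_subseq (u := fun m => ∑ i ∈ Finset.range m, D i ω)
    (φ := ns) (l := atTop) (monotone_sum_range fun i => (hω i).le) ?_⟩
  have hn : Tendsto (fun j => (ns j : ℝ)) atTop atTop :=
    tendsto_natCast_atTop_atTop.comp hns.tendsto_atTop
  refine (hn.atTop_mul_pos hc hl).congr' ?_
  filter_upwards [hn.eventually_gt_atTop 0] with j hj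
  simp only [Function.comp_apply, smul_eq_mul]
  field_simp

/-- `S m` lies between its values at the neighbouring multiples of `p`, across which the line rises
by only `c p`. -/
theorem abs_sub_le_of_grid {S : ℕ → ℝ} (hS : Monotone S) {c δ : ℝ} (hc : 0 ≤ c) (hδ : 0 ≤ δ)
    {K p : ℕ} (hp : 0 < p)
    (h : ∀ i ≤ K + 1, |S (i * p) - (i * p : ℕ) * c| ≤ δ * (i * p : ℕ)) {m : ℕ} (hm : m ≤ K * p) :
    |S m - m * c| ≤ (δ * (K + 1) + c) * p := by
  have hj : m / p ≤ K := Nat.div_le_of_le_mul (by rwa [mul_comm])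
  have m1 : m / p * p ≤ m := Nat.div_mul_le_self m p
  have m2 : m ≤ (m / p + 1) * p := (Nat.lt_mul_of_div_lt (Nat.lt_succ_self _) hp).le
  generalize m / p = j at hj m1 m2
  have h1 := (abs_le.1 (h j (by omega))).1
  have h2 := (abs_le.1 (h (j + 1) (by omega))).2
  have s1 := hS m1
  have s2 := hS m2
  have r1 : (j : ℝ) * p ≤ m := by exact_mod_cast m1
  have r2 : (m : ℝ) ≤ (j + 1) * p := by exact_mod_cast m2
  have hj' : (j : ℝ) ≤ K := by exact_mod_cast hj
  push_cast at h1 h2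
  have c1 : (j : ℝ) * p * c ≤ m * c := by gcongr
  have c2 : (m : ℝ) * c ≤ (j + 1) * p * c := by gcongr
  have e1 : δ * ((j : ℝ) * p) ≤ δ * (K + 1) * p := by
    rw [← mul_assoc]; gcongr; linarith
  have e2 : δ * (((j : ℝ) + 1) * p) ≤ δ * (K + 1) * p := by
    rw [← mul_assoc]; gcongr
  rw [abs_le]
  constructor <;> linarith

/-- The weak law of large numbers for nonnegative random variables is uniform. -/
theorem WeakLLN.tendsto_measure_exists_abs_sub_gt {Ω : Type*} [MeasurableSpace Ω] {P : Measure Ω}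
    {D : ℕ → Ω → ℝ} (hpos : ∀ᵐ ω ∂P, ∀ i, 0 ≤ D i ω) {c : ℝ} (hc : 0 ≤ c) (h : WeakLLN D P c)
    (M : ℕ) {η : ℝ} (hη : 0 < η) :
    Tendsto (fun n : ℕ => P {ω | ∃ m ≤ M * n,
      η * n < |∑ i ∈ Finset.range m, D i ω - m * c|}) atTop (𝓝 0) := by
  -- The grid has mesh `n / J + 1`. With `δ (K + 1) = 1` the grid lemma gives an error of `1 + c`
  -- meshes, below `η n` for large `n`.
  obtain ⟨J, hJ⟩ := exists_nat_gt ((1 + c) / η)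
  have hJ0 : (0 : ℝ) < J := lt_of_le_of_lt (by positivity) hJ
  have hJ0' : 0 < J := by exact_mod_cast hJ0
  set K := M * J with hK
  set δ : ℝ := 1 / (K + 1) with hδdef
  have hδ : 0 < δ := by positivity
  -- The number of grid points does not depend on `n`, so a union bound suffices.
  have hlim : Tendsto (fun n : ℕ => ∑ i ∈ Finset.range (K + 1),
      P {ω | ENNReal.ofReal δ ≤ edist ((((i + 1) * (n / J + 1) : ℕ) : ℝ)⁻¹ •
        ∑ l ∈ Finset.range ((i + 1) * (n / J + 1)), D l ω) c}) atTop (𝓝 0) := by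
    rw [show (0 : ℝ≥0∞) = ∑ i ∈ Finset.range (K + 1), 0 by simp]
    refine tendsto_finsetSum _ fun i _ => ?_
    have hq : Tendsto (fun n : ℕ => (i + 1) * (n / J + 1)) atTop atTop := by
      refine tendsto_atTop_mono (fun n => ?_) (Nat.tendsto_div_const_atTop hJ0'.ne')
      have : 0 ≤ i * (n / J + 1) := Nat.zero_le _
      nlinarith
    have h' := h (ENNReal.ofReal δ) (ENNReal.ofReal_pos.2 hδ)
    exact h'.comp hq
  refine tendsto_of_tendsto_of_tendsto_of_le_of_le' tendsto_const_nhds hlim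
    (Eventually.of_forall fun _ => zero_le) ?_
  have hlarge : ∀ᶠ n : ℕ in atTop, (1 + c) * (n / J + 1) ≤ η * n := by
    have hgap : 0 < η - (1 + c) / J := by
      rw [sub_pos, div_lt_iff₀ hJ0]
      rw [div_lt_iff₀ hη] at hJ
      linarith
    filter_upwards [tendsto_natCast_atTop_atTop.eventually_ge_atTop
      ((1 + c) / (η - (1 + c) / J))] with n hn
    rw [div_le_iff₀ hgap] at hn
    have : (1 + c) * ((n : ℝ) / J + 1) = (1 + c) / J * n + (1 + c) := by ring
    linarith
  filter_upwards [hlarge] with n hn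
  refine (measure_mono_ae ?_).trans (measure_biUnion_finset_le (Finset.range (K + 1)) _)
  filter_upwards [hpos] with ω hω
  rintro ⟨m, hm, hlt⟩
  by_contra hcon
  have hcon' : ω ∉ ⋃ i ∈ Finset.range (K + 1), {ω | ENNReal.ofReal δ ≤
      edist ((((i + 1) * (n / J + 1) : ℕ) : ℝ)⁻¹ •
        ∑ l ∈ Finset.range ((i + 1) * (n / J + 1)), D l ω) c} := hcon
  simp only [Set.mem_iUnion, Finset.mem_range, not_exists] at hcon'
  have hm' : m ≤ K * (n / J + 1) := by
    refine hm.trans ?_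
    rw [hK, mul_assoc]
    exact Nat.mul_le_mul_left _ (Nat.lt_mul_div_succ n hJ0').le
  refine absurd hlt (not_lt.2 ?_)
  refine (abs_sub_le_of_grid (monotone_sum_range hω) hc hδ.le (Nat.succ_pos (n / J)) ?_ hm').trans
    (le_trans ?_ hn)
  · rintro (_ | i) hi
    · simp
    · have hb := hcon' i (by omega)
      have hb' : edist ((((i + 1) * (n / J + 1) : ℕ) : ℝ)⁻¹ •
        ∑ l ∈ Finset.range ((i + 1) * (n / J + 1)), D l ω) c < ENNReal.ofReal δ := not_le.1 hb
      rw [edist_lt_ofReal, Real.dist_eq, smul_eq_mul] at hb'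
      have hq : (0 : ℝ) < (((i + 1) * (n / J + 1) : ℕ) : ℝ) := by positivity
      show |∑ l ∈ Finset.range ((i + 1) * (n / J + 1)), D l ω - _| ≤ _
      generalize (i + 1) * (n / J + 1) = q at hb' hq
      have e : ∑ l ∈ Finset.range q, D l ω - q * c =
          q * ((q : ℝ)⁻¹ * ∑ l ∈ Finset.range q, D l ω - c) := by field_simp
      rw [e, abs_mul, abs_of_pos hq, mul_comm]
      gcongr
  · have : δ * (K + 1) = 1 := by rw [hδdef]; field_simp
    rw [this]
    gcongr
    push_cast
    gcongr
    exact Nat.cast_div_le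

/-! ### The sums of order sizes -/

/-- A bound on all partial sums in terms of the sums over consecutive blocks of length `L`. -/
theorem norm_sum_range_le_block {E : Type*} [NormedAddCommGroup E] (u : ℕ → E) {L N m : ℕ}
    (hL : 0 < L) (hm : m ≤ L * N) {a : ℝ} (ha : 0 < a) :
    ‖∑ i ∈ Finset.range m, u i‖ ≤
      ∑ j ∈ Finset.range N, ‖∑ i ∈ Finset.range L, u (L * j + i)‖ +
        L * (a + a⁻¹ * ∑ i ∈ Finset.range (L * (N + 1)), ‖u i‖ ^ 2) := by
  have hblock : ∀ q, ∑ i ∈ Finset.range (L * q), u i =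
      ∑ j ∈ Finset.range q, ∑ i ∈ Finset.range L, u (L * j + i) := by
    intro q
    induction q with
    | zero => simp
    | succ q ih => rw [Nat.mul_succ, Finset.sum_range_add, ih, Finset.sum_range_succ]
  have hq : m / L ≤ N := Nat.div_le_of_le_mul hm
  have hr : m % L < L := Nat.mod_lt _ hL
  conv_lhs => rw [← Nat.div_add_mod m L, Finset.sum_range_add, hblock]
  refine (norm_add_le _ _).trans (add_le_add ?_ ?_)
  · refine (norm_sum_le _ _).trans (Finset.sum_le_sum_of_subset_of_nonneg ?_ ?_)
    · exact Finset.range_mono hq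
    · intros; positivity
  · have hterm : ∀ i ∈ Finset.range (m % L), ‖u (L * (m / L) + i)‖ ≤
        a + a⁻¹ * ∑ i ∈ Finset.range (L * (N + 1)), ‖u i‖ ^ 2 := by
      intro i hi
      rw [Finset.mem_range] at hi
      have hmem : L * (m / L) + i ∈ Finset.range (L * (N + 1)) := by
        rw [Finset.mem_range, Nat.mul_succ]
        have := Nat.mul_le_mul_left L hq
        omega
      have h1 := Finset.single_le_sum (f := fun i => ‖u i‖ ^ 2) (fun _ _ => by positivity) hmem
      -- Passing to squares with a free weight `a` bounds the incomplete block by an expression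
      -- independent of `m`, whose mean is small relative to `n` for `a` of order `n`.
      have h2 : ‖u (L * (m / L) + i)‖ ≤ a + a⁻¹ * ‖u (L * (m / L) + i)‖ ^ 2 := by
        have h3 : 0 ≤ (‖u (L * (m / L) + i)‖ - a) ^ 2 := sq_nonneg _
        have h4 : 0 ≤ a * ‖u (L * (m / L) + i)‖ := by positivity
        rw [← div_eq_inv_mul, ← sub_le_iff_le_add', le_div_iff₀ ha]
        nlinarith
      refine h2.trans ?_
      gcongr
    refine (norm_sum_le _ _).trans ((Finset.sum_le_card_nsmul _ _ _ hterm).trans ?_)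
    rw [Finset.card_range, nsmul_eq_mul]
    have : 0 ≤ ∑ i ∈ Finset.range (L * (N + 1)), ‖u i‖ ^ 2 :=
      Finset.sum_nonneg fun _ _ => by positivity
    gcongr

theorem IsStationarySeq.identDistrib {Ω E : Type*} [MeasurableSpace Ω] [MeasurableSpace E]
    {P : Measure Ω} {V : ℕ → Ω → E} (h : IsStationarySeq V P) (k : ℕ) :
    IdentDistrib (V k) (V 0) P P := by
  have := (h k).comp (measurable_pi_apply 0)
  simpa [Function.comp_def] using this

section

variable {Ω E : Type*} [MeasurableSpace Ω] [NormedAddCommGroup E]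
  [MeasurableSpace E] [BorelSpace E] {P : Measure Ω} {V : ℕ → Ω → E}

theorem IsStationarySeq.integral_norm_block [SecondCountableTopology E] (h : IsStationarySeq V P) (w : E) (k L : ℕ) :
    ∫ ω, ‖∑ i ∈ Finset.range L, (V (k + i) ω - w)‖ ∂P =
      ∫ ω, ‖∑ i ∈ Finset.range L, (V i ω - w)‖ ∂P := by
  have hm : Measurable fun x : ℕ → E => ‖∑ i ∈ Finset.range L, (x i - w)‖ := by fun_prop
  have := ((h k).comp hm).integral_eq
  simpa [Function.comp_def, add_comm k] using this

theorem IsStationarySeq.integral_norm_sq (h : IsStationarySeq V P) (w : E) (k : ℕ) :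
    ∫ ω, ‖V k ω - w‖ ^ 2 ∂P = ∫ ω, ‖V 0 ω - w‖ ^ 2 ∂P := by
  have hm : Measurable fun x : E => ‖x - w‖ ^ 2 := by fun_prop
  exact ((h.identDistrib k).comp hm).integral_eq

variable [NormedSpace ℝ E] [IsProbabilityMeasure P]

/-- For a stationary integrable sequence the weak law of large numbers holds in mean. -/
theorem WeakLLN.exists_integral_norm_sum_sub_le {w : E} (hlln : WeakLLN V P w)
    (hstat : IsStationarySeq V P) (hint : Integrable (V 0) P) {ε : ℝ} (hε : 0 < ε) :
    ∃ L : ℕ, 0 < L ∧ ∫ ω, ‖∑ i ∈ Finset.range L, (V i ω - w)‖ ∂P ≤ ε * L := by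
  -- Uniform integrability passes to averages, and Vitali's theorem then upgrades convergence in
  -- probability to `L¹`.
  have hui : UniformIntegrable V 1 P := MemLp.uniformIntegrable_of_identDistrib le_rfl
    ENNReal.one_ne_top (memLp_one_iff_integrable.2 hint) hstat.identDistrib
  have hav := uniformIntegrable_average le_rfl hui
  have hfun : (fun (n : ℕ) ω => (n : ℝ)⁻¹ • ∑ i ∈ Finset.range n, V i ω) =
      fun (n : ℕ) => (n : ℝ)⁻¹ • ∑ i ∈ Finset.range n, V i := by
    ext n ω; simp
  rw [WeakLLN, hfun] at hlln
  have hlim := tendsto_Lp_finite_of_tendstoInMeasure le_rfl ENNReal.one_ne_top hav.1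
    (memLp_const w) hav.2.1 hlln
  obtain ⟨L, hL, hL0⟩ := ((hlim.eventually_lt_const (ENNReal.ofReal_pos.2 hε)).and
    (eventually_gt_atTop 0)).exists
  refine ⟨L, hL0, ?_⟩
  have hL0' : (0 : ℝ) < L := by exact_mod_cast hL0
  rw [eLpNorm_one_eq_lintegral_enorm, ← ofReal_integral_norm_eq_lintegral_enorm,
    ENNReal.ofReal_lt_ofReal_iff hε] at hL
  · calc ∫ ω, ‖∑ i ∈ Finset.range L, (V i ω - w)‖ ∂P
        = ∫ ω, L * ‖((L : ℝ)⁻¹ • ∑ i ∈ Finset.range L, V i - fun _ => w : Ω → E) ω‖ ∂P := by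
          congr 1
          ext ω
          have hsum : ∑ i ∈ Finset.range L, (V i ω - w) =
              (L : ℝ) • ((L : ℝ)⁻¹ • ∑ i ∈ Finset.range L, V i - fun _ => w : Ω → E) ω := by
            simp only [Pi.sub_apply, Pi.smul_apply, Finset.sum_apply, smul_sub,
              smul_inv_smul₀ hL0'.ne', Finset.sum_sub_distrib, Finset.sum_const, Finset.card_range,
              Nat.cast_smul_eq_nsmul]
          rw [hsum, norm_smul, Real.norm_of_nonneg hL0'.le]
      _ = L * ∫ ω, ‖((L : ℝ)⁻¹ • ∑ i ∈ Finset.range L, V i - fun _ => w : Ω → E) ω‖ ∂P :=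
          integral_const_mul _ _
      _ ≤ _ := by rw [mul_comm]; gcongr
  · refine Integrable.sub (Integrable.smul _ (integrable_finsetSum' _ fun i _ => ?_))
      (integrable_const w)
    exact (hstat.identDistrib i).integrable_iff.2 hint

/-- The weak law of large numbers for a stationary square-integrable sequence is uniform. -/
theorem WeakLLN.tendsto_measure_exists_norm_sub_gt [SecondCountableTopology E] {w : E}
    (hlln : WeakLLN V P w) (hstat : IsStationarySeq V P) (hV : ∀ i, MemLp (V i) 2 P)
    (M : ℕ) {η : ℝ} (hη : 0 < η) :
    Tendsto (fun n : ℕ => P {ω | ∃ m ≤ M * n,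
      η * n < ‖∑ i ∈ Finset.range m, V i ω - (m : ℝ) • w‖}) atTop (𝓝 0) := by
  have hU : ∀ i, MemLp (fun ω => V i ω - w) 2 P := fun i => (hV i).sub (memLp_const w)
  have hUint : ∀ i, Integrable (fun ω => V i ω - w) P := fun i =>
    (hU i).integrable (by norm_num)
  have hUsq : ∀ i, Integrable (fun ω => ‖V i ω - w‖ ^ 2) P := fun i => (hU i).integrable_norm_pow'
  set σ : ℝ := ∫ ω, ‖V 0 ω - w‖ ^ 2 ∂P with hσ
  have hσ0 : 0 ≤ σ := integral_nonneg fun _ => by positivity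
  -- One random variable dominating all centred partial sums up to `L N`.
  let W : ℕ → ℕ → ℝ → Ω → ℝ := fun L N a ω =>
    ∑ j ∈ Finset.range N, ‖∑ i ∈ Finset.range L, (V (L * j + i) ω - w)‖ +
      L * (a + a⁻¹ * ∑ i ∈ Finset.range (L * (N + 1)), ‖V i ω - w‖ ^ 2)
  have hW1 : ∀ L N, Integrable (fun ω =>
      ∑ j ∈ Finset.range N, ‖∑ i ∈ Finset.range L, (V (L * j + i) ω - w)‖) P := fun L N =>
    integrable_finsetSum _ fun j _ => (integrable_finsetSum _ fun i _ => hUint _).norm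
  have hW2 : ∀ L N : ℕ, Integrable (fun ω =>
      ∑ i ∈ Finset.range (L * (N + 1)), ‖V i ω - w‖ ^ 2) P := fun L N =>
    integrable_finsetSum _ fun i _ => hUsq i
  have hW3 : ∀ (L N : ℕ) (a : ℝ), Integrable (fun ω =>
      L * (a + a⁻¹ * ∑ i ∈ Finset.range (L * (N + 1)), ‖V i ω - w‖ ^ 2)) P := fun L N a =>
    ((integrable_const a).add ((hW2 L N).const_mul _)).const_mul _
  have hWint : ∀ L N a, Integrable (W L N a) P := fun L N a => (hW1 L N).add (hW3 L N a)
  have hWE : ∀ L N a, ∫ ω, W L N a ω ∂P =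
      N * ∫ ω, ‖∑ i ∈ Finset.range L, (V i ω - w)‖ ∂P +
        L * (a + a⁻¹ * ((L * (N + 1) : ℕ) * σ)) := by
    intro L N a
    simp only [W]
    rw [integral_add (hW1 L N) (hW3 L N a), integral_const_mul,
      integral_add (integrable_const a) ((hW2 L N).const_mul _), integral_const_mul,
      integral_finsetSum _ (fun j _ => (integrable_finsetSum _ fun i _ => hUint _).norm),
      integral_finsetSum _ (fun i _ => hUsq i)]
    simp only [hstat.integral_norm_block, hstat.integral_norm_sq, ← hσ, integral_const,
      probReal_univ, one_smul, Finset.sum_const, Finset.card_range, nsmul_eq_mul]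
  rw [ENNReal.tendsto_atTop_zero]
  intro r hr
  -- The aim is mean at most `κ n` for `W`; Markov's inequality at level `η n` then gives `κ / η`.
  obtain ⟨κ, hκ0, hκ⟩ : ∃ κ : ℝ, 0 < κ ∧ ENNReal.ofReal (κ / η) ≤ r := by
    rcases eq_or_ne r ⊤ with rfl | hr'
    · exact ⟨1, one_pos, le_top⟩
    · refine ⟨r.toReal * η, mul_pos (ENNReal.toReal_pos hr.ne' hr') hη, ?_⟩
      rw [mul_div_cancel_right₀ _ hη.ne', ENNReal.ofReal_toReal hr']
  -- About `M n / L` blocks at this price cost at most `κ n / 4` in total, up to a constant.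
  obtain ⟨L, hL, hLint⟩ := hlln.exists_integral_norm_sum_sub_le hstat
    ((hV 0).integrable (by norm_num)) (show 0 < κ / (4 * (M + 1)) by positivity)
  have hL' : (0 : ℝ) < L := by exact_mod_cast hL
  have hlarge : ∀ᶠ n : ℕ in atTop,
      κ * L / 4 + 4 * L ^ 3 * (2 * M + 1) * σ / κ ≤ κ / 2 * n := by
    refine Tendsto.eventually_ge_atTop ?_ _
    exact tendsto_natCast_atTop_atTop.const_mul_atTop (by positivity)
  obtain ⟨n₀, hn₀⟩ := eventually_atTop.1 (hlarge.and (eventually_gt_atTop 0))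
  refine ⟨n₀, fun n hn => ?_⟩
  obtain ⟨hbig, hn0⟩ := hn₀ n hn
  have hn0' : (0 : ℝ) < n := by exact_mod_cast hn0
  set N := M * (n / L + 1) with hN
  -- `L a` is another `κ n / 4`, and the term with `a⁻¹` stays bounded as `n` grows.
  set a : ℝ := κ * n / (4 * L) with ha
  have ha0 : 0 < a := by positivity
  have hEW : ∫ ω, W L N a ω ∂P ≤ κ * n := by
    rw [hWE]
    have hN1 : (N : ℝ) ≤ M * (n / L + 1) := by
      rw [hN]; push_cast; gcongr; exact Nat.cast_div_le
    have hN2 : (N : ℝ) + 1 ≤ (2 * M + 1) * n := by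
      have hone : 1 ≤ n := hn0
      have : N + 1 ≤ (2 * M + 1) * n := by
        have h1 : n / L ≤ n := Nat.div_le_self _ _
        have h2 : N ≤ M * (n + n) := Nat.mul_le_mul_left _ (by omega)
        nlinarith
      exact_mod_cast this
    have t1 : N * ∫ ω, ‖∑ i ∈ Finset.range L, (V i ω - w)‖ ∂P ≤ κ / 4 * (n + L) := by
      calc _ ≤ (M * ((n : ℝ) / L + 1)) * (κ / (4 * (M + 1)) * L) := by gcongr
        _ = M / (M + 1) * (κ / 4 * (n + L)) := by field_simp
        _ ≤ 1 * (κ / 4 * (n + L)) := by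
            gcongr
            exact (div_le_one (by positivity)).2 (by linarith)
        _ = _ := one_mul _
    have t2 : (L : ℝ) * (a + a⁻¹ * ((L * (N + 1) : ℕ) * σ)) ≤
        κ / 4 * n + 4 * L ^ 3 * (2 * M + 1) * σ / κ := by
      calc (L : ℝ) * (a + a⁻¹ * ((L * (N + 1) : ℕ) * σ))
          = κ / 4 * n + 4 * L ^ 3 * σ / (κ * n) * (N + 1) := by
            rw [ha]; push_cast; field_simp
        _ ≤ κ / 4 * n + 4 * L ^ 3 * σ / (κ * n) * ((2 * M + 1) * n) := by gcongr
        _ = _ := by field_simp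
    linarith
  have hsub : {ω | ∃ m ≤ M * n, η * n < ‖∑ i ∈ Finset.range m, V i ω - (m : ℝ) • w‖} ⊆
      {ω | η * n ≤ W L N a ω} := by
    rintro ω ⟨m, hm, hlt⟩
    have hmN : m ≤ L * N := by
      refine hm.trans ?_
      rw [hN, mul_left_comm]
      exact Nat.mul_le_mul_left _ (Nat.lt_mul_div_succ n hL).le
    have := norm_sum_range_le_block (fun i => V i ω - w) hL hmN ha0
    rw [Finset.sum_sub_distrib, Finset.sum_const, Finset.card_range,
      ← Nat.cast_smul_eq_nsmul ℝ] at this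
    exact hlt.le.trans this
  have hWnn : 0 ≤ᵐ[P] W L N a := Eventually.of_forall fun ω => by
    simp only [W, Pi.zero_apply]; positivity
  have hmarkov := mul_meas_ge_le_integral_of_nonneg hWnn (hWint L N a) (η * n)
  refine (measure_mono hsub).trans (le_trans ?_ hκ)
  rw [← ofReal_measureReal]
  refine ENNReal.ofReal_le_ofReal ?_
  rw [le_div_iff₀ hη]
  have h1 := hmarkov.trans hEW
  have h2 : (P.real {ω | η * n ≤ W L N a ω} * η) * n ≤ κ * n := by linarith
  exact le_of_mul_le_mul_right h2 hn0'

end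

/-! ### Measurability and convergence of the net order flow -/

section

variable {Ω E : Type*} [MeasurableSpace Ω] [NormedAddCommGroup E] [NormedSpace ℝ E]
  [MeasurableSpace E] [BorelSpace E] [SecondCountableTopology E] {P : Measure Ω}
  {D : ℕ → Ω → ℝ} {V : ℕ → Ω → E}

/-- The net order flow is a random element of the Skorokhod space. -/
theorem aemeasurable_ofFun_netOrderFlow (hDmeas : ∀ i, Measurable (D i))
    (hVmeas : ∀ i, Measurable (V i))
    (hD : ∀ᵐ ω ∂P, (∀ i, 0 < D i ω) ∧
      Tendsto (fun m => ∑ i ∈ Finset.range m, D i ω) atTop atTop) {T : ℝ} (hT : 0 ≤ T) (n : ℕ) :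
    AEMeasurable (fun ω => CadlagPath.ofFun (fun t : Set.Icc (0 : ℝ) T =>
      netOrderFlow (fun i => D i ω) (fun i => V i ω) n t)) P := by
  rcases Nat.eq_zero_or_pos n with rfl | hn
  · simp only [netOrderFlow, Nat.cast_zero, inv_zero, zero_smul]
    exact aemeasurable_const
  have hn' : (0 : ℝ) < n := by exact_mod_cast hn
  let S : ℕ → Ω → ℝ := fun m ω => ∑ i ∈ Finset.range m, D i ω
  have hS : ∀ m, Measurable (S m) := fun m => Finset.measurable_sum _ fun i _ => hDmeas i
  let s : ∀ k : ℕ, Ω → Fin k → ℝ := fun k ω i => S (i + 1) ω / n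
  let v : ∀ k : ℕ, Ω → Fin k → E := fun k ω i => (n : ℝ)⁻¹ • V i ω
  have hs : ∀ k, Measurable (s k) := fun k => measurable_pi_lambda _ fun i => (hS _).div_const _
  have hv : ∀ k, Measurable (v k) := fun k => measurable_pi_lambda _ fun i =>
    (hVmeas i).const_smul _
  let A : ℕ → Set Ω := fun k => {ω | S k ω ≤ n * T} ∩ {ω | n * T < S (k + 1) ω}
  have hA : ∀ k, MeasurableSet (A k) := fun k =>
    (measurableSet_le (hS k) measurable_const).inter (measurableSet_lt measurable_const (hS _))
  -- The index records `k = N(nT)` and which of the `k` jumps occur at `T`: countably many cases.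
  let B : (Σ k : ℕ, Set (Fin k)) → Set Ω := fun p => A p.1 ∩ s p.1 ⁻¹' jumpTimes T p.2
  have hcover : ∀ᵐ ω ∂P, ω ∈ ⋃ p, B p := by
    filter_upwards [hD] with ω hω
    have hnn : ∀ i, 0 ≤ D i ω := fun i => (hω.1 i).le
    have hnT : 0 ≤ (n : ℝ) * T := by positivity
    set k := arrivalCount (fun i => D i ω) (n * T) with hk
    have hle : ∀ m, m ≤ k ↔ S m ω ≤ n * T := fun m => le_arrivalCount_iff hnn hω.2 hnT
    have hmono : StrictMono fun m => S m ω := strictMono_nat_of_lt_succ fun m => by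
      simp only [S, Finset.sum_range_succ]
      exact lt_add_of_pos_right _ (hω.1 m)
    refine Set.mem_iUnion.2 ⟨⟨k, {i | s k ω i = T}⟩, ⟨(hle k).1 le_rfl, ?_⟩, ?_, ?_, ?_, ?_⟩
    · exact not_le.1 fun h => absurd ((hle (k + 1)).2 h) (by omega)
    · intro i j hij
      exact div_lt_div_of_pos_right (hmono (Nat.succ_lt_succ hij)) hn'
    · intro i
      refine div_pos ?_ hn'
      have := hmono (Nat.succ_pos (i : ℕ))
      simpa [S] using this
    · intro i
      rw [div_le_iff₀ hn', mul_comm]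
      exact (hle _).1 i.2
    · exact fun i => Iff.rfl
  have hrestr : P.restrict (⋃ p, B p) = P := Measure.restrict_eq_self_of_ae_mem hcover
  rw [← hrestr, aemeasurable_iUnion_iff]
  rintro ⟨k, J⟩
  have hBm : MeasurableSet (B ⟨k, J⟩) := (hA k).inter (hs k (measurableSet_jumpTimes T J))
  have hjump : AEMeasurable (fun ω => jumpPath T (s k ω) (v k ω)) (P.restrict (B ⟨k, J⟩)) :=
    (aemeasurable_restrict_jumpPath P hT J (hs k) (hv k)).mono_measure
      (Measure.restrict_mono Set.inter_subset_right le_rfl)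
  refine hjump.congr ?_
  filter_upwards [ae_restrict_of_ae hD, ae_restrict_mem hBm] with ω hω hB
  have hnn : ∀ i, 0 ≤ D i ω := fun i => (hω.1 i).le
  have hnT : 0 ≤ (n : ℝ) * T := by positivity
  have hk : arrivalCount (fun i => D i ω) (n * T) = k := by
    refine le_antisymm ?_ ((le_arrivalCount_iff hnn hω.2 hnT).2 hB.1.1)
    by_contra h
    exact absurd ((le_arrivalCount_iff hnn hω.2 hnT).1 (not_le.1 h)) (not_le.2 hB.1.2)
  exact (ofFun_netOrderFlow_eq_jumpPath hnn hω.2 (fun i => V i ω) hn hk).symm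

/-- The net order flow converges in probability, uniformly on `[0, T]`, to a linear path. -/
theorem tendstoInMeasure_ofFun_netOrderFlow [IsProbabilityMeasure P] {lam : ℝ} (hlam : 0 < lam)
    {w : E} (hDlln : WeakLLN D P (1 / lam))
    (hD : ∀ᵐ ω ∂P, (∀ i, 0 < D i ω) ∧
      Tendsto (fun m => ∑ i ∈ Finset.range m, D i ω) atTop atTop)
    (hVsq : ∀ i, MemLp (V i) 2 P) (hVstat : IsStationarySeq V P) (hVlln : WeakLLN V P w)
    (T : ℝ) :
    TendstoInMeasure P (fun (n : ℕ) ω => CadlagPath.ofFun (fun t : Set.Icc (0 : ℝ) T =>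
      netOrderFlow (fun i => D i ω) (fun i => V i ω) n t)) atTop
      (fun _ => linearPath T lam w) := by
  refine tendstoInMeasure_of_ne_top fun ε hε hε' => ?_
  lift ε to NNReal using hε'
  have hε0 : (0 : ℝ) < ε := by exact_mod_cast hε
  obtain ⟨η, hη, hηε⟩ : ∃ η : ℝ, 0 < η ∧ η + (lam * η + η) * ‖w‖ < ε := by
    have hc : ContinuousAt (fun η : ℝ => η + (lam * η + η) * ‖w‖) 0 := by fun_prop
    have hev : ∀ᶠ η : ℝ in 𝓝[>] 0, η + (lam * η + η) * ‖w‖ < ε :=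
      nhdsWithin_le_nhds (hc.eventually_lt continuousAt_const (by simpa using hε0))
    exact (hev.and self_mem_nhdsWithin).exists.imp fun _ h => ⟨h.2, h.1⟩
  -- This horizon keeps `N(nT)` below `M n` on the good event.
  obtain ⟨M, hM⟩ := exists_nat_gt ((T + η) * lam)
  rw [← lt_div_iff₀ hlam] at hM
  have h1 := hDlln.tendsto_measure_exists_abs_sub_gt
    (hD.mono fun ω hω i => (hω.1 i).le) (by positivity) M hη
  have h2 := hVlln.tendsto_measure_exists_norm_sub_gt hVstat hVsq M hη
  have h3 := h1.add h2
  rw [add_zero] at h3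
  refine tendsto_of_tendsto_of_tendsto_of_le_of_le' tendsto_const_nhds h3
    (Eventually.of_forall fun _ => zero_le) ?_
  have hsmall : ∀ᶠ n : ℕ in atTop, 1 / (n : ℝ) < η :=
    tendsto_one_div_atTop_nhds_zero_nat.eventually_lt_const hη
  filter_upwards [hsmall, eventually_gt_atTop 0] with n hnη hn
  refine (measure_mono_ae ?_).trans (measure_union_le _ _)
  filter_upwards [hD] with ω hω hmem
  by_contra hcon
  have hcon' := not_or.1 hcon
  have hb1 : ∀ m ≤ M * n, |∑ i ∈ Finset.range m, D i ω - m / lam| ≤ η * n := by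
    intro m hm
    by_contra hlt
    exact hcon'.1 ⟨m, hm, by rw [mul_one_div]; exact not_le.1 hlt⟩
  have hb2 : ∀ m ≤ M * n, ‖∑ i ∈ Finset.range m, V i ω - (m : ℝ) • w‖ ≤ η * n := by
    intro m hm
    by_contra hlt
    exact hcon'.2 ⟨m, hm, not_le.1 hlt⟩
  have hnn : ∀ i, 0 ≤ D i ω := fun i => (hω.1 i).le
  refine absurd (show (ε : ℝ≥0∞) ≤ _ from hmem) (not_le.2 ?_)
  refine (CadlagPath.edist_le_iSup _ _).trans_lt ?_
  rw [CadlagPath.ofFun_eq (isCadlag_netOrderFlow hnn hω.2 (fun i => V i ω) n T)]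
  refine lt_of_le_of_lt (b := ENNReal.ofReal (η + (lam * η + η) * ‖w‖)) (iSup_le fun t => ?_) ?_
  · rw [edist_dist, dist_eq_norm]
    refine ENNReal.ofReal_le_ofReal ((norm_netOrderFlow_sub_le hnn hω.2 hn hlam hb1 hb2 hM
      t.2.1 t.2.2).trans ?_)
    gcongr
  · rw [← ENNReal.ofReal_coe_nnreal]
    exact (ENNReal.ofReal_lt_ofReal_iff hε0).2 hηε

end

end

theorem theorem2p1 {Ω : Type*} [MeasurableSpace Ω] (P : Measure Ω) [IsProbabilityMeasure P]
    (D : ℕ → Ω → ℝ) (V : ℕ → Ω → EuclideanSpace ℝ (Fin 6))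
    (lam : ℝ) (hlam : 0 < lam) (Vbar : EuclideanSpace ℝ (Fin 6))
    (hDmeas : ∀ i, Measurable (D i)) (hDpos : ∀ i, ∀ᵐ ω ∂P, 0 < D i ω)
    (hDstat : IsStationarySeq D P) (hDlln : WeakLLN D P (1 / lam))
    (hVmeas : ∀ i, Measurable (V i)) (hVsq : ∀ i, MemLp (V i) 2 P)
    (hVstat : IsStationarySeq V P) (hVlln : WeakLLN V P Vbar)
    (T : ℝ) (hT : 0 < T) :
    (∀ᵐ ω ∂P, ∀ t : ℝ, 0 ≤ t →
      IsGreatest {m : ℕ | ∑ i ∈ Finset.range m, D i ω ≤ t} (arrivalCount (fun i => D i ω) t)) ∧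
    (∀ᵐ ω ∂P, ∀ n : ℕ, IsCadlag (fun t : Set.Icc (0 : ℝ) T =>
      netOrderFlow (fun i => D i ω) (fun i => V i ω) n t)) ∧
    TendstoInDistribution
      (fun (n : ℕ) ω => CadlagPath.ofFun (fun t : Set.Icc (0 : ℝ) T =>
        netOrderFlow (fun i => D i ω) (fun i => V i ω) n t))
      atTop (fun _ => linearPath T lam Vbar) (fun _ => P) P := by
  have hD := ae_pos_and_tendsto_sum_atTop hDpos (one_div_pos.2 hlam) hDlln
  refine ⟨?_, ?_, ?_⟩
  · filter_upwards [hD] with ω hω t ht using isGreatest_arrivalCount hω.2 ht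
  · filter_upwards [hD] with ω hω n using
      isCadlag_netOrderFlow (fun i => (hω.1 i).le) hω.2 (fun i => V i ω) n T
  · exact (tendstoInMeasure_ofFun_netOrderFlow hlam hDlln hD hVsq hVstat hVlln
      T).tendstoInDistribution fun n => aemeasurable_ofFun_netOrderFlow hDmeas hVmeas hD hT.le n
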